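/- Let $\mathcal V$ be a finite vocabulary, $K\ge 1$ and $L\ge 0$ integers, and let $p,q$ be two autoregressive models (target and draft): each assigns to every finite sequence $a_{1:i}$ over $\mathcal V$ a next-token distribution $p(\cdot\mid a_{1:i})$, $q(\cdot\mid a_{1:i})$ on $\mathcal V$. Write $p(a_{1:i})=\prod_{j=1}^{i}p(a_j\mid a_{1:j-1})$, similarly $q(a_{1:i})$; let $p_n,q_n$ be the resulting laws on $\mathcal V^n$, and $\mathcal V^{\le n}=\bigcup_{i\le n}\mathcal V^i$. A $K$-path verification algorithm $\Phi$ is a randomized rule which, for every block length $L$, receives the full joint distributions $p_{L+1}$ and $q_L$ and $K$ i.i.d. draft blocks $X^{(1)},\dots,X^{(K)}\sim q_L$, and returns a nonempty sequence in $\mathcal V^{\le L+1}$, written $(X_{1:\tau},Y)$ with $Y$ its last token and $\tau\in\{0,\dots,L\}$. It is *prefix-matching* on $(L,p,q)$ if almost surely $X_{1:\tau}$ is a prefix of some $X^{(k)}$, *target-matching* on $(L,p,q)$ if appending $L-\tau$ further tokens sampled from $p(\cdot\mid X_{1:\tau},Y)$ autoregressively gives a sequence with law $p_{L+1}$, *valid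 on* $(L,p,q)$ if both hold, and *valid* if it is valid on every $(L,p,q)$. Its node budgets on $(L,p,q)$ are, for $a_{1:i}\in\mathcal V^{\le L+1}$ with $p(a_{1:i})>0$, $$D_\Phi(a_{1:i})=1-\sum_{j=1}^{i}\frac{\mathbb P\big((X_{1:\tau},Y)=a_{1:j}\big)}{p(a_{1:j})}.$$ Call a function $D$ defined on the sequences $a_{1:i}\in\mathcal V^{\le L+1}$ with $p(a_{1:i})>0$ (all of $\mathcal V^{\le L+1}$ if $p$ has full support) *feasible* if - $1=D(a_{1:0})\ge D(a_{1:1})\ge\dots\ge D(a_{1:L})\ge D(a_{1:L+1})=0$ for all $a_{1:L+1}\in\mathcal V^{L+1}$ with $p(a_{1:L+1})>0$; - $1-\sum_{a\in T}D(a)p(a)\ge\big(1-\sum_{a\in T}q(a)\big)^K$ for every antichain $T\subseteq\mathcal V^{\le L}$ of the prefix order (terms $D(a)p(a)$ with $p(a)=0$ being $0$). **Theorem.** Fix $K,L,p,q$. 1. A $K$-path verification algorithm $\Phi$ is valid on $(L,p,q)$ if and only if it is prefix-matching on $(L,p,q)$ and its node budgets $D_\Phi$ are feasible. 2. A function $D$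 is feasible if and only if it is the node budget function on $(L,p,q)$ of some valid $K$-path verification algorithm. 3. Whenever the node budgets of $\Phi$ are feasible (in particular, whenever $\Phi$ is valid), the objective $\sum_{a\in\mathcal V^{\le L}}D_\Phi(a)p(a)$ equals the block efficiency $\mathbb E[\tau+1]$ of $\Phi$. -/

import Mathlib

namespace SpecDec

/-- An autoregressive model over the vocabulary `V`: to the tokens generated so far (after a fixed,
suppressed context) it assigns the distribution of the next token. -/
abbrev LanguageModel (V : Type*) : Type _ := List V → PMF V

/-- The probability `p(a₁ … aₖ) = ∏ᵢ p(aᵢ | a₁ … aᵢ₋₁)` of a finite sequence. -/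
noncomputable def seqProb {V : Type*} (p : LanguageModel V) (a : List V) : ℝ :=
  ∏ i : Fin a.length, (p (a.take i) (a.get i)).toReal

/-- The law of the next `n` tokens sampled autoregressively after the tokens `c`;
`generate p n []` is the joint `n`-step distribution of the model. -/
noncomputable def generate {V : Type*} (p : LanguageModel V) :
    (n : ℕ) → List V → PMF (List.Vector V n)
  | 0, _ => PMF.pure List.Vector.nil
  | n + 1, c => (p c).bind fun x => (generate p n (c ++ [x])).map fun z => List.Vector.cons x z

/-- The law of `K` independent samples from `μ`. -/
noncomputable def iid {α : Type*} (μ : PMF α) : (K : ℕ) → PMF (Fin K → α)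
  | 0 => PMF.pure Fin.elim0
  | K + 1 => μ.bind fun x => (iid μ K).map fun f => Fin.cons (α := fun _ => α) x f

/-- The set `V^{≤ n}` of sequences of length at most `n`. -/
noncomputable def seqsLE (V : Type*) [Finite V] (n : ℕ) : Finset (List V) :=
  (List.finite_length_le V n).toFinset

/-- The possible outputs for block length `L`: nonempty sequences in `V^{≤ L+1}`. An output
`(X₁, …, X_τ, Y)` has length `τ + 1`. -/
abbrev Output (V : Type*) (L : ℕ) : Type _ := {o : List V // o ≠ [] ∧ o.length ≤ L + 1}

/-- A (randomized) `K`-path verification algorithm. For every block length `L` it receives the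
full joint target distribution of the next `L + 1` tokens, the full joint draft distribution of the
next `L` tokens, and `K` draft blocks, and returns a random output. -/
abbrev KPathAlgorithm (V : Type*) (K : ℕ) : Type _ :=
  (L : ℕ) → (target : PMF (List.Vector V (L + 1))) → (draft : PMF (List.Vector V L)) →
    (blocks : Fin K → List.Vector V L) → PMF (Output V L)

namespace KPathAlgorithm

variable {V : Type*} {K : ℕ}

/-- The randomized rule used for block length `L`, target model `p` and draft model `q`. -/
noncomputable def rule (Φ : KPathAlgorithm V K) (L : ℕ) (p q : LanguageModel V) :
    (Fin K → List.Vector V L) → PMF (Output V L) :=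
  Φ L (generate p (L + 1) []) (generate q L [])

/-- The law of the output, when the `K` blocks are drawn i.i.d. from the draft model. -/
noncomputable def outputLaw (Φ : KPathAlgorithm V K) (L : ℕ) (p q : LanguageModel V) :
    PMF (List V) :=
  (iid (generate q L []) K).bind fun X => (Φ.rule L p q X).map Subtype.val

/-- Prefix-matching: almost surely, the output without its last token is a prefix of one of the
drawn blocks. -/
def PrefixMatching (Φ : KPathAlgorithm V K) (L : ℕ) (p q : LanguageModel V) : Prop :=
  ∀ X ∈ (iid (generate q L []) K).support, ∀ o ∈ (Φ.rule L p q X).support,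
    ∃ k : Fin K, o.val.dropLast <+: (X k).toList

/-- Target-matching: completing the output to `L + 1` tokens by sampling from the target model gives
a sequence with the law of `L + 1` tokens sampled from the target model. -/
def TargetMatching (Φ : KPathAlgorithm V K) (L : ℕ) (p q : LanguageModel V) : Prop :=
  ((Φ.outputLaw L p q).bind fun o =>
      (generate p (L + 1 - o.length) o).map fun z => o ++ z.toList) =
    (generate p (L + 1) []).map List.Vector.toList

/-- Validity on the instance `(L, p, q)`. -/
def IsValidFor (Φ : KPathAlgorithm V K) (L : ℕ) (p q : LanguageModel V) : Prop :=
  Φ.PrefixMatching L p q ∧ Φ.TargetMatching L p q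

/-- Validity: prefix-matching and target-matching for all block lengths and all models. -/
def IsValid (Φ : KPathAlgorithm V K) : Prop :=
  ∀ (L : ℕ) (p q : LanguageModel V), Φ.IsValidFor L p q

/-- The node budgets `D_Φ(a₁ … aᵢ) = 1 - ∑_{j=1}^{i} ℙ(output = a₁ … aⱼ) / p(a₁ … aⱼ)`. They are
meaningful at the sequences with `p(a₁ … aᵢ) ≠ 0`. -/
noncomputable def nodeBudget (Φ : KPathAlgorithm V K) (L : ℕ) (p q : LanguageModel V)
    (a : List V) : ℝ :=
  1 - ∑ j ∈ Finset.Icc 1 a.length, (Φ.outputLaw L p q (a.take j)).toReal / seqProb p (a.take j)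

/-- The block efficiency `𝔼[τ + 1]`, the expected length of the output. -/
noncomputable def blockEfficiency [Finite V] (Φ : KPathAlgorithm V K) (L : ℕ)
    (p q : LanguageModel V) : ℝ :=
  ∑ o ∈ seqsLE V (L + 1), (Φ.outputLaw L p q o).toReal * (o.length : ℝ)

end KPathAlgorithm

/-- The constraints of the multi-path information-agnostic linear program. The budgets `D` are
variables at the sequences `a ∈ V^{≤ L+1}` with `p a ≠ 0` (all of `V^{≤ L+1}` if `p` has full
support); at other sequences `D` occurs only multiplied by `p a = 0`. -/
structure IsFeasible {V : Type*} [Finite V] (K L : ℕ) (p q : LanguageModel V)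
    (D : List V → ℝ) : Prop where
  root : D [] = 1
  antitone : ∀ a : List V, a.length = L + 1 → seqProb p a ≠ 0 →
    ∀ i ≤ L, D (a.take (i + 1)) ≤ D (a.take i)
  leaf : ∀ a : List V, a.length = L + 1 → seqProb p a ≠ 0 → D a = 0
  antichain : ∀ T ⊆ seqsLE V L, IsAntichain (fun a b => a <+: b) (T : Set (List V)) →
    (1 - ∑ a ∈ T, seqProb q a) ^ K ≤ 1 - ∑ a ∈ T, D a * seqProb p a

/-- The objective `∑_{a ∈ V^{≤ L}} D(a) p(a)` of the linear program. -/
noncomputable def objective {V : Type*} [Finite V] (L : ℕ) (p : LanguageModel V)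
    (D : List V → ℝ) : ℝ :=
  ∑ a ∈ seqsLE V L, D a * seqProb p a

end SpecDec

/-!
The whole argument rests on one identity. Write `m o` for the probability of the output `o`. If
`m (a ++ [x]) = (D a - D (a ++ [x])) * p (a ++ [x])` at every node and `D` vanishes at the leaves,
then the total mass of the outputs strictly extending `a` is `D a * p a` (`sum_strict_extensions`,
by induction from the leaves). The node budgets satisfy the displayed recursion by definition
wherever `p` is positive.

*Validity and feasibility.* A leaf `a` with `p a > 0` is the completed output with probability
`(1 - D a) * p a` (`toReal_completedLaw_apply`), so target-matching says exactly that the budgets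
vanish at the leaves (`targetMatching_iff`); leaves of target probability zero take care of
themselves because both laws have mass one. For an antichain `T`, the sum of `D t * p t` over `T` is
the probability that the output without its last token passes through `T`. By prefix-matching some
draft block then passes through `T`, which has probability `1 - (1 - ∑ q t) ^ K`
(`sum_iid_generate_exists_prefix`). Summing the identity over all nodes counts the strict prefixes of
the output, which gives the block efficiency (`objective_nodeBudget`).

*Realizing a feasible `D`.* The output law `m` is determined by `D`, and prefix-matching asks for a
coupling of `m` with the law of the draft blocks carried by the relation "the output without its last
token is a prefix of some block". By Strassen's theorem (`exists_coupling_of_hall`, obtained here by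
separating the marginals of a missing coupling and comparing superlevel sets of the separating
functional) it exists if no set of outputs has more mass than its neighbours. A set of outputs can be
enlarged to all strict extensions of an antichain without changing its neighbours, and for those
Hall's condition is the antichain constraint (`IsFeasible.hall`). Conditioning the coupling on the
blocks gives the rule; on all other instances the algorithm samples one token from the target.
-/

/-! ### Couplings of finite distributions -/

theorem intervalIntegrable_ite_lt (c x y : ℝ) :
    IntervalIntegrable (fun t => if t < c then (1 : ℝ) else 0) MeasureTheory.volume x y := by
  refine Antitone.intervalIntegrable fun s t hst => ?_
  split_ifs <;> linarith

theorem intervalIntegrable_sum_ite_lt {γ : Type*} [Fintype γ] (m g : γ → ℝ) (x y : ℝ) :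
    IntervalIntegrable (fun t => ∑ c, m c * (if t < g c then (1 : ℝ) else 0))
      MeasureTheory.volume x y := by
  have := IntervalIntegrable.sum Finset.univ fun c (_ : c ∈ Finset.univ) =>
    (intervalIntegrable_ite_lt (g c) x y).const_mul (m c)
  simpa only [Finset.sum_fn] using this

/-- The layer-cake formula: the expectation of `g`, shifted by a bound `M` of `|g|`, is the integral
of the masses of its superlevel sets. -/
theorem integral_sum_ite_lt {γ : Type*} [Fintype γ] (m g : γ → ℝ) {M : ℝ} (hg : ∀ c, |g c| ≤ M) :
    ∫ t in (-M)..M, ∑ c, m c * (if t < g c then (1 : ℝ) else 0) =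
      ∑ c, m c * g c + (∑ c, m c) * M := by
  have hlayer : ∀ c, ∫ t in (-M)..M, (if t < g c then (1 : ℝ) else 0) = g c + M := by
    intro c
    obtain ⟨h1, h2⟩ := abs_le.mp (hg c)
    rw [← intervalIntegral.integral_add_adjacent_intervals
        (intervalIntegrable_ite_lt (g c) (-M) (g c)) (intervalIntegrable_ite_lt (g c) (g c) M),
      intervalIntegral.integral_congr_Ioo_of_le (g := fun _ => (1 : ℝ)) h1
        (fun t ht => by simp [ht.2]),
      intervalIntegral.integral_congr_Ioo_of_le (g := fun _ => (0 : ℝ)) h2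
        (fun t ht => by simp [ht.1.le])]
    simp
  rw [intervalIntegral.integral_finsetSum fun c _ =>
    (intervalIntegrable_ite_lt _ _ _).const_mul _]
  simp only [intervalIntegral.integral_const_mul, hlayer, mul_add, Finset.sum_add_distrib,
    ← Finset.sum_mul]

/-- The expectation of `f` is at most that of `h` if `h` stochastically dominates `f`. -/
theorem sum_mul_le_sum_mul_of_superlevel {α β : Type*} [Fintype α] [Fintype β]
    {μ f : α → ℝ} {ν h : β → ℝ} (hμν : ∑ a, μ a = ∑ b, ν b)
    (hfh : ∀ t : ℝ, ∑ a with t < f a, μ a ≤ ∑ b with t < h b, ν b) :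
    ∑ a, μ a * f a ≤ ∑ b, ν b * h b := by
  obtain ⟨M, hM, hMf, hMh⟩ : ∃ M : ℝ, 0 ≤ M ∧ (∀ a, |f a| ≤ M) ∧ ∀ b, |h b| ≤ M := by
    have hf : 0 ≤ ∑ a, |f a| := Finset.sum_nonneg fun _ _ => abs_nonneg _
    have hh : 0 ≤ ∑ b, |h b| := Finset.sum_nonneg fun _ _ => abs_nonneg _
    exact ⟨∑ a, |f a| + ∑ b, |h b|, add_nonneg hf hh,
      fun a => (Finset.single_le_sum (f := fun a => |f a|) (fun _ _ => abs_nonneg _)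
        (Finset.mem_univ a)).trans (le_add_of_nonneg_right hh),
      fun b => (Finset.single_le_sum (f := fun b => |h b|) (fun _ _ => abs_nonneg _)
        (Finset.mem_univ b)).trans (le_add_of_nonneg_left hf)⟩
  have key : ∫ t in (-M)..M, ∑ a, μ a * (if t < f a then (1 : ℝ) else 0) ≤
      ∫ t in (-M)..M, ∑ b, ν b * (if t < h b then (1 : ℝ) else 0) := by
    refine intervalIntegral.integral_mono (by linarith) (intervalIntegrable_sum_ite_lt μ f _ _)
      (intervalIntegrable_sum_ite_lt ν h _ _) fun t => ?_
    simpa [Finset.sum_filter, mul_ite] using hfh t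
  rw [integral_sum_ite_lt μ f hMf, integral_sum_ite_lt ν h hMh, hμν] at key
  linarith

/-- **Strassen's theorem** for finite distributions: `μ` and `ν` have a coupling carried by the
relation `R` if every set has at most the `ν`-mass of any set containing its `R`-neighbours. -/
theorem exists_coupling_of_hall {α β : Type*} [Fintype α] [Fintype β] (R : α → β → Prop)
    (μ : α → ℝ) (ν : β → ℝ) (hμ : ∑ a, μ a = 1) (hν : ∑ b, ν b = 1)
    (hall : ∀ (A : Finset α) (B : Finset β), (∀ a ∈ A, ∀ b, R a b → b ∈ B) →
      ∑ a ∈ A, μ a ≤ ∑ b ∈ B, ν b) :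
    ∃ π : α → β → ℝ, (∀ a b, 0 ≤ π a b) ∧ (∀ a b, ¬ R a b → π a b = 0) ∧
      (∀ a, ∑ b, π a b = μ a) ∧ ∀ b, ∑ a, π a b = ν b := by
  classical
  -- `S` is the set of distributions carried by `R`, and `G` maps a distribution to its marginals
  let G : (α × β → ℝ) →ₗ[ℝ] (α → ℝ) × (β → ℝ) :=
    LinearMap.prod
      (LinearMap.pi fun a => ∑ b, LinearMap.proj (a, b))
      (LinearMap.pi fun b => ∑ a, LinearMap.proj (a, b))
  let S : Set (α × β → ℝ) := stdSimplex ℝ (α × β) ∩ {w | ∀ a b, ¬ R a b → w (a, b) = 0}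
  have hSconv : Convex ℝ S := by
    refine (convex_stdSimplex ℝ _).inter ?_
    intro x hx y hy s t _ _ _ a b hab
    simp [hx a b hab, hy a b hab]
  have hScomp : IsCompact S := by
    refine (isCompact_stdSimplex ℝ (α × β)).inter_right ?_
    simp only [Set.ofPred_forall]
    exact isClosed_iInter fun a => isClosed_iInter fun b => isClosed_iInter fun _ =>
      isClosed_eq (continuous_apply _) continuous_const
  by_cases hmem : (μ, ν) ∈ G '' S
  · obtain ⟨w, ⟨hw, hwR⟩, hG⟩ := hmem
    refine ⟨fun a b => w (a, b), fun a b => hw.1 _, hwR, fun a => ?_, fun b => ?_⟩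
    · simpa [G] using congrFun (congrArg Prod.fst hG) a
    · simpa [G] using congrFun (congrArg Prod.snd hG) b
  exfalso
  obtain ⟨φ, u, hφ, hu⟩ := geometric_hahn_banach_closed_point (hSconv.linear_image G)
    (hScomp.image G.continuous_of_finiteDimensional).isClosed hmem
  let f : α → ℝ := fun a => φ (Pi.single a 1, 0)
  let g : β → ℝ := fun b => φ (0, Pi.single b 1)
  have hdec : ∀ (x : α → ℝ) (y : β → ℝ), φ (x, y) = ∑ a, x a * f a + ∑ b, y b * g b := by
    intro x y
    have h : (x, y) = ∑ a, x a • ((Pi.single a 1 : α → ℝ), (0 : β → ℝ)) +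
        ∑ b, y b • ((0 : α → ℝ), (Pi.single b 1 : β → ℝ)) := by
      refine Prod.ext (funext fun c => ?_) (funext fun c => ?_) <;>
        simp [Prod.fst_sum, Prod.snd_sum, Finset.sum_apply, Pi.single_apply]
    rw [h]
    simp only [map_add, map_sum, map_smul, smul_eq_mul, f, g]
  have hR : ∀ a b, R a b → f a < u - g b := by
    intro a b hab
    have h1 : Pi.single (a, b) 1 ∈ S := by
      refine ⟨single_mem_stdSimplex ℝ _, fun a' b' hab' => ?_⟩
      rw [Pi.single_apply, if_neg]
      rintro ⟨rfl, rfl⟩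
      exact hab' hab
    have h2 := hφ _ ⟨_, h1, rfl⟩
    have h3 : G (Pi.single (a, b) 1) = (Pi.single a 1, Pi.single b 1) := by
      refine Prod.ext (funext fun c => ?_) (funext fun c => ?_) <;>
        simp [G, Pi.single_apply, ite_and]
    rw [h3, hdec] at h2
    simp [Pi.single_apply] at h2
    linarith
  rw [hdec] at hu
  -- Hall's condition on superlevel sets says that `u - g` dominates `f`, against the separation
  have := sum_mul_le_sum_mul_of_superlevel (f := f) (h := fun b => u - g b) (hμ.trans hν.symm)
    fun t => hall _ _ fun a ha b hab => by
      have := hR a b hab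
      simp only [Finset.mem_filter, Finset.mem_univ, true_and] at ha ⊢
      linarith
  simp only [mul_sub, Finset.sum_sub_distrib, ← Finset.sum_mul, hν, one_mul] at this
  linarith

/-! ### Probability mass functions on finite sets -/

namespace PMF

theorem bind_map_apply_of_injective {α β γ : Type*} (μ : PMF α) (κ : α → PMF β) {g : α → β → γ}
    (hg : Function.Injective2 g) (x : α) (y : β) :
    (μ.bind fun x => (κ x).map (g x)) (g x y) = μ x * κ x y := by
  classical
  rw [bind_apply, tsum_eq_single x, map_apply, tsum_eq_single y, if_pos rfl]
  · intro y' hy'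
    exact if_neg fun h => hy' (hg h).2.symm
  · intro x' hx'
    rw [map_apply, ENNReal.tsum_eq_zero.mpr, mul_zero]
    intro y'
    exact if_neg fun h => hx' (hg h).1.symm

theorem map_apply_of_injective {α β : Type*} (μ : PMF α) {g : α → β}
    (hg : Function.Injective g) (x : α) : μ.map g (g x) = μ x := by
  classical
  rw [map_apply, tsum_eq_single x, if_pos rfl]
  intro x' hx'
  exact if_neg fun h => hx' (hg h).symm

theorem sum_toReal {α : Type*} [Fintype α] (μ : PMF α) : ∑ a, (μ a).toReal = 1 := by
  rw [← ENNReal.toReal_sum fun a _ => μ.apply_ne_top a, ← tsum_fintype (L := .unconditional _),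
    μ.tsum_coe, ENNReal.toReal_one]

theorem sum_toReal_le_one {α : Type*} (μ : PMF α) (s : Finset α) :
    ∑ a ∈ s, (μ a).toReal ≤ 1 := by
  rw [← ENNReal.toReal_sum fun a _ => μ.apply_ne_top a]
  refine ENNReal.toReal_le_of_le_ofReal zero_le_one ?_
  rw [ENNReal.ofReal_one, ← μ.tsum_coe]
  exact ENNReal.sum_le_tsum s

theorem toReal_bind_apply {α β : Type*} [Fintype α] (μ : PMF α) (κ : α → PMF β) (b : β) :
    (μ.bind κ b).toReal = ∑ a, (μ a).toReal * (κ a b).toReal := by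
  rw [bind_apply, tsum_fintype, ENNReal.toReal_sum fun a _ =>
    ENNReal.mul_ne_top (μ.apply_ne_top a) ((κ a).apply_ne_top b)]
  simp

theorem toReal_pos_iff {α : Type*} (μ : PMF α) (a : α) : 0 < (μ a).toReal ↔ a ∈ μ.support := by
  rw [ENNReal.toReal_pos_iff, mem_support_iff, pos_iff_ne_zero]
  exact and_iff_left (μ.apply_lt_top a)

theorem toReal_ne_zero_iff {α : Type*} (μ : PMF α) (a : α) :
    (μ a).toReal ≠ 0 ↔ a ∈ μ.support := by
  rw [← toReal_pos_iff, ENNReal.toReal_nonneg.lt_iff_ne, ne_comm]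

/-- Two distributions agree as soon as they agree on the support of one of them, since nothing is
left for the other points. -/
theorem eq_of_eqOn_support {α : Type*} {μ ν : PMF α} (h : ∀ a ∈ ν.support, μ a = ν a) :
    μ = ν := by
  have hle : ∀ a, ν a ≤ μ a := fun a => by
    by_cases ha : a ∈ ν.support
    · exact (h a ha).ge
    · rw [(ν.apply_eq_zero_iff a).mpr ha]; exact zero_le
  ext a
  by_contra hne
  have hlt := ENNReal.tsum_lt_tsum (i := a) ν.tsum_coe_ne_top hle ((hle a).lt_of_ne (Ne.symm hne))
  rw [ν.tsum_coe, μ.tsum_coe] at hlt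
  exact lt_irrefl _ hlt

/-- A distribution on a finite type given by real weights. -/
noncomputable def ofReal {α : Type*} [Fintype α] (w : α → ℝ) (hw : ∀ a, 0 ≤ w a)
    (h1 : ∑ a, w a = 1) : PMF α :=
  PMF.ofFintype (fun a => ENNReal.ofReal (w a)) (by
    rw [← ENNReal.ofReal_sum_of_nonneg fun a _ => hw a, h1, ENNReal.ofReal_one])

theorem toReal_ofReal_apply {α : Type*} [Fintype α] (w : α → ℝ) (hw : ∀ a, 0 ≤ w a)
    (h1 : ∑ a, w a = 1) (a : α) : (ofReal w hw h1 a).toReal = w a := by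
  rw [ofReal, ofFintype_apply, ENNReal.toReal_ofReal (hw a)]

end PMF

namespace SpecDec

theorem iid_apply {α : Type*} (μ : PMF α) : ∀ (K : ℕ) (f : Fin K → α), iid μ K f = ∏ k, μ (f k)
  | 0, f => by simp [iid, Subsingleton.elim f Fin.elim0]
  | K + 1, f => by
    rw [Fin.prod_univ_succ, ← iid_apply μ K fun k => f k.succ, iid]
    have h := PMF.bind_map_apply_of_injective μ (fun _ => iid μ K)
      (g := fun x f => Fin.cons (α := fun _ => α) x f)
      (fun _ _ _ _ h => Fin.cons_injective2 h) (f 0) (Fin.tail f)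
    rwa [Fin.cons_self_tail] at h

open scoped Classical in
/-- The probability that one of `K` independent samples lies in `A`. -/
theorem sum_iid_exists {α : Type*} [Fintype α] (μ : PMF α) (K : ℕ) (A : α → Prop) :
    ∑ f : Fin K → α with ∃ k, A (f k), (iid μ K f).toReal =
      1 - (1 - ∑ x with A x, (μ x).toReal) ^ K := by
  have hc : 1 - ∑ x with A x, (μ x).toReal = ∑ x with ¬ A x, (μ x).toReal := by
    rw [← μ.sum_toReal, ← Finset.sum_filter_add_sum_filter_not _ A]; ring
  have hpow : (∑ x with ¬ A x, (μ x).toReal) ^ K =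
      ∑ f : Fin K → α with ¬ ∃ k, A (f k), (iid μ K f).toReal := by
    have h := Finset.prod_univ_sum (fun _ : Fin K => Finset.univ.filter fun x => ¬ A x)
      (fun _ x => (μ x).toReal)
    rw [Finset.prod_const, Finset.card_univ, Fintype.card_fin] at h
    rw [h]
    refine Finset.sum_congr ?_ fun f _ => by rw [iid_apply, ENNReal.toReal_prod]
    ext f
    simp [Fintype.mem_piFinset]
  rw [hc, hpow, ← (iid μ K).sum_toReal, eq_sub_iff_add_eq,
    Finset.sum_filter_add_sum_filter_not]

/-! ### Sequence probabilities -/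

variable {V : Type*}

@[simp] theorem seqProb_nil (p : LanguageModel V) : seqProb p [] = 1 := by simp [seqProb]

theorem seqProb_cons (p : LanguageModel V) (x : V) (a : List V) :
    seqProb p (x :: a) = (p [] x).toReal * seqProb (fun b => p (x :: b)) a := by
  simp [seqProb, Fin.prod_univ_succ]

theorem seqProb_append (p : LanguageModel V) (a b : List V) :
    seqProb p (a ++ b) = seqProb p a * seqProb (fun d => p (a ++ d)) b := by
  induction a generalizing p with
  | nil => simp
  | cons x a ih => simp [seqProb_cons, ih, mul_assoc]

theorem seqProb_concat (p : LanguageModel V) (a : List V) (x : V) :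
    seqProb p (a ++ [x]) = seqProb p a * (p a x).toReal := by
  simp [seqProb_append, seqProb_cons]

theorem seqProb_nonneg (p : LanguageModel V) (a : List V) : 0 ≤ seqProb p a :=
  Finset.prod_nonneg fun _ _ => ENNReal.toReal_nonneg

theorem sum_seqProb_concat [Fintype V] (p : LanguageModel V) (a : List V) :
    ∑ x, seqProb p (a ++ [x]) = seqProb p a := by
  simp [seqProb_concat, ← Finset.mul_sum, PMF.sum_toReal]

theorem seqProb_take_ne_zero {p : LanguageModel V} {a : List V} (h : seqProb p a ≠ 0) (j : ℕ) :
    seqProb p (a.take j) ≠ 0 := by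
  rw [← List.take_append_drop j a, seqProb_append] at h
  exact left_ne_zero_of_mul h

theorem seqProb_ne_zero_of_concat {p : LanguageModel V} {a : List V} {x : V}
    (h : seqProb p (a ++ [x]) ≠ 0) : seqProb p a ≠ 0 := by
  rw [seqProb_concat] at h
  exact left_ne_zero_of_mul h

theorem toReal_generate (p : LanguageModel V) : ∀ (n : ℕ) (c : List V) (v : List.Vector V n),
    (generate p n c v).toReal = seqProb (fun b => p (c ++ b)) v.toList
  | 0, c, v => by simp [generate, Subsingleton.elim v List.Vector.nil]
  | n + 1, c, v => by
    have h := PMF.bind_map_apply_of_injective (p c) (fun x => generate p n (c ++ [x]))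
      (g := fun x z => List.Vector.cons x z)
      (fun x y z w h => ⟨by simpa using congrArg List.Vector.head h,
        by simpa using congrArg List.Vector.tail h⟩) v.head v.tail
    rw [List.Vector.cons_head_tail] at h
    rw [generate, h, ENNReal.toReal_mul, toReal_generate]
    conv_rhs => rw [← List.Vector.cons_head_tail v, List.Vector.toList_cons, seqProb_cons]
    simp

theorem toReal_generate_nil (p : LanguageModel V) (n : ℕ) (v : List.Vector V n) :
    (generate p n [] v).toReal = seqProb p v.toList := toReal_generate p n [] v

theorem exists_extension {p : LanguageModel V} {a : List V} (ha : seqProb p a ≠ 0) (n : ℕ) :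
    ∃ b : List V, b.length = n ∧ seqProb p (a ++ b) ≠ 0 := by
  obtain ⟨v, hv⟩ := (generate p n a).support_nonempty
  refine ⟨v.toList, v.toList_length, ?_⟩
  rw [seqProb_append, ← toReal_generate]
  exact mul_ne_zero ha ((PMF.toReal_ne_zero_iff _ _).mpr hv)

open scoped Classical in
/-- The probability that a sampled block starts with `a` is `seqProb p a`. -/
theorem sum_generate_prefix [Fintype V] (p : LanguageModel V) (n : ℕ) (a : List V)
    (ha : a.length ≤ n) :
    ∑ v : List.Vector V n with a <+: v.toList, (generate p n [] v).toReal = seqProb p a := by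
  obtain ⟨m, rfl⟩ := Nat.exists_eq_add_of_le ha
  rw [← mul_one (seqProb p a), ← (generate p m a).sum_toReal, Finset.mul_sum]
  symm
  let e : List.Vector V m → List.Vector V (a.length + m) := fun z => ⟨a ++ z.toList, by simp⟩
  have he : ∀ z, (e z).toList = a ++ z.toList := fun _ => rfl
  refine Finset.sum_bij (fun z _ => e z) (fun z _ => ?_) (fun z _ w _ h => ?_) (fun v hv => ?_)
    (fun z _ => ?_)
  · simp [he]
  · exact List.Vector.eq _ _ (List.append_cancel_left (congrArg Subtype.val h))
  · obtain ⟨b, hb⟩ := (Finset.mem_filter.mp hv).2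
    refine ⟨⟨b, ?_⟩, Finset.mem_univ _, List.Vector.eq _ _ hb⟩
    have := congrArg List.length hb
    simp at this
    exact this
  · rw [toReal_generate, toReal_generate_nil, ← seqProb_append, he]

theorem seqProb_eq_of_generate_eq [Finite V] {p p' : LanguageModel V} {n : ℕ}
    (h : generate p n [] = generate p' n []) {a : List V} (ha : a.length ≤ n) :
    seqProb p a = seqProb p' a := by
  cases nonempty_fintype V
  rw [← sum_generate_prefix p n a ha, ← sum_generate_prefix p' n a ha, h]

/-! ### Prefixes and antichains -/

theorem mem_seqsLE [Finite V] {n : ℕ} {a : List V} : a ∈ seqsLE V n ↔ a.length ≤ n := by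
  simp [seqsLE]

theorem prefix_iff_eq_or_prefix_dropLast (a o : List V) :
    a <+: o ↔ a = o ∨ (o ≠ [] ∧ a <+: o.dropLast) := by
  rcases List.eq_nil_or_concat o with rfl | ⟨b, x, rfl⟩
  · simp
  · simp [List.prefix_concat_iff]

open scoped Classical in
theorem ite_prefix_dropLast_eq_sum [Fintype V] (a o : List V) (c : ℝ) :
    (if o ≠ [] ∧ a <+: o.dropLast then c else 0) = ∑ x, if a ++ [x] <+: o then c else 0 := by
  split_ifs with h
  · obtain ⟨ho, t, ht⟩ := h
    obtain ⟨z, s, hzs⟩ : ∃ z s, t ++ [o.getLast ho] = z :: s :=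
      List.exists_cons_of_ne_nil (by simp)
    have ho' : o = a ++ z :: s := by
      rw [← hzs, ← List.append_assoc, ht, List.dropLast_append_getLast]
    simp [ho', List.prefix_append_right_inj]
  · refine (Finset.sum_eq_zero fun x _ => if_neg ?_).symm
    rintro ⟨t, rfl⟩
    refine h ⟨by simp, ?_⟩
    rw [List.append_assoc, List.dropLast_append_of_ne_nil (by simp)]
    exact List.prefix_append _ _

open scoped Classical in
/-- A sequence has at most one prefix in an antichain. -/
theorem sum_ite_prefix_of_isAntichain {T : Finset (List V)}
    (hT : IsAntichain (fun a b => a <+: b) (T : Set (List V))) (o : List V) (c : ℝ) :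
    ∑ a ∈ T, (if a <+: o then c else 0) = if ∃ a ∈ T, a <+: o then c else 0 := by
  split_ifs with h
  · obtain ⟨a, ha, hao⟩ := h
    rw [Finset.sum_eq_single_of_mem a ha, if_pos hao]
    intro b hb hba
    refine if_neg fun hbo => ?_
    rcases List.prefix_or_prefix_of_prefix hao hbo with h | h
    · exact hT ha hb hba.symm h
    · exact hT hb ha hba h
  · exact Finset.sum_eq_zero fun a ha => if_neg fun hao => h ⟨a, ha, hao⟩

/-- The prefix-minimal elements of a finite set form an antichain below the whole set. -/
theorem exists_antichain_prefix (B : Finset (List V)) :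
    ∃ T ⊆ B, IsAntichain (fun a b => a <+: b) (T : Set (List V)) ∧
      ∀ b ∈ B, ∃ t ∈ T, t <+: b := by
  classical
  refine ⟨B.filter fun t => ∀ b ∈ B, b <+: t → b = t, Finset.filter_subset _ _, ?_, ?_⟩
  · intro s hs t ht hst h
    simp only [Finset.coe_filter, Set.mem_ofPred_eq] at hs ht
    exact hst (ht.2 s hs.1 h)
  · intro b hb
    obtain ⟨t, ht, hmin⟩ := (B.filter (· <+: b)).exists_min_image List.length
      ⟨b, by simp [hb]⟩
    simp only [Finset.mem_filter] at ht hmin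
    refine ⟨t, Finset.mem_filter.mpr ⟨ht.1, fun c hc hct => ?_⟩, ht.2⟩
    exact hct.eq_of_length_le (hmin c ⟨hc, hct.trans ht.2⟩)

open scoped Classical in
/-- The probability that one of `K` independent draft blocks passes through the antichain `T`. -/
theorem sum_iid_generate_exists_prefix [Fintype V] (K : ℕ) (q : LanguageModel V) {L : ℕ}
    {T : Finset (List V)} (hTL : T ⊆ seqsLE V L)
    (hT : IsAntichain (fun a b => a <+: b) (T : Set (List V))) :
    ∑ X : Fin K → List.Vector V L with ∃ k, ∃ t ∈ T, t <+: (X k).toList,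
      (iid (generate q L []) K X).toReal = 1 - (1 - ∑ t ∈ T, seqProb q t) ^ K := by
  refine (Finset.sum_congr (by ext; simp) fun _ _ => rfl).trans
    ((sum_iid_exists _ K fun v : List.Vector V L => ∃ t ∈ T, t <+: v.toList).trans ?_)
  congr 3
  rw [Finset.sum_filter]
  trans ∑ v : List.Vector V L, ∑ t ∈ T,
    if t <+: v.toList then (generate q L [] v).toReal else 0
  · refine Finset.sum_congr rfl fun v _ => ?_
    rw [sum_ite_prefix_of_isAntichain hT]
    congr
  rw [Finset.sum_comm]
  refine Finset.sum_congr rfl fun t ht => ?_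
  rw [← Finset.sum_filter, sum_generate_prefix q L t (mem_seqsLE.mp (hTL ht))]

/-! ### Budgets and output masses -/

open scoped Classical in
/-- If the output mass `m` at each node is the drop of the budget `D` there, weighted by the target
probability, and no budget is left at the leaves, then the mass strictly below a node `a` is
`D a * seqProb p a`. -/
theorem sum_strict_extensions [Fintype V] (p : LanguageModel V) (n : ℕ) (m D : List V → ℝ)
    (hstep : ∀ a x, a.length < n → m (a ++ [x]) = (D a - D (a ++ [x])) * seqProb p (a ++ [x]))
    (hleaf : ∀ a, a.length = n → D a * seqProb p a = 0) (a : List V) (ha : a.length ≤ n) :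
    ∑ o ∈ seqsLE V n with o ≠ [] ∧ a <+: o.dropLast, m o = D a * seqProb p a := by
  obtain ⟨k, hk⟩ := Nat.exists_eq_add_of_le ha
  induction k generalizing a with
  | zero =>
    rw [hleaf a (by omega), Finset.filter_false_of_mem, Finset.sum_empty]
    rintro o ho ⟨hne, hpre⟩
    have h1 := hpre.length_le
    have h2 := List.length_pos_iff.mpr hne
    have h3 := mem_seqsLE.mp ho
    rw [List.length_dropLast] at h1
    omega
  | succ k ih =>
    have hsplit : ∀ x o, (if a ++ [x] <+: o then m o else 0) =
        (if o = a ++ [x] then m o else 0) +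
          if o ≠ [] ∧ a ++ [x] <+: o.dropLast then m o else 0 := by
      intro x o
      by_cases h : o = a ++ [x]
      · subst h
        rw [if_pos (List.prefix_refl _), if_pos rfl, if_neg, add_zero]
        rintro ⟨-, h⟩
        have := h.length_le
        simp at this
      · simp only [prefix_iff_eq_or_prefix_dropLast (a ++ [x]) o, Ne.symm h, false_or, if_neg h,
          zero_add]
    have hmem : ∀ x, a ++ [x] ∈ seqsLE V n := fun x => mem_seqsLE.mpr (by simp; omega)
    simp only [Finset.sum_filter, ite_prefix_dropLast_eq_sum a]
    rw [Finset.sum_comm, ← sum_seqProb_concat p a, Finset.mul_sum]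
    refine Finset.sum_congr rfl fun x _ => ?_
    have hx := ih (a ++ [x]) (by simp; omega) (by simp; omega)
    rw [Finset.sum_filter] at hx
    simp only [hsplit]
    rw [Finset.sum_add_distrib, hx, Finset.sum_ite_eq', if_pos (hmem x), hstep a x (by omega)]
    ring

/-! ### Target-matching and node budgets -/

namespace KPathAlgorithm

variable {K : ℕ} (Φ : KPathAlgorithm V K) (L : ℕ) (p q : LanguageModel V)

@[simp] theorem nodeBudget_nil : Φ.nodeBudget L p q [] = 1 := by simp [nodeBudget]

theorem nodeBudget_concat (a : List V) (x : V) :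
    Φ.nodeBudget L p q (a ++ [x]) = Φ.nodeBudget L p q a -
      (Φ.outputLaw L p q (a ++ [x])).toReal / seqProb p (a ++ [x]) := by
  rw [nodeBudget, nodeBudget, List.length_append, List.length_singleton,
    Finset.sum_Icc_succ_top (by omega), List.take_of_length_le (by simp), sub_sub]
  congr 2
  refine Finset.sum_congr rfl fun j hj => ?_
  rw [List.take_append_of_le_length (Finset.mem_Icc.mp hj).2]

theorem of_mem_support_outputLaw {o : List V} (ho : o ∈ (Φ.outputLaw L p q).support) :
    o ≠ [] ∧ o.length ≤ L + 1 := by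
  obtain ⟨X, -, hX⟩ := (PMF.mem_support_bind_iff _ _ _).mp ho
  obtain ⟨o', -, rfl⟩ := (PMF.mem_support_map_iff _ _ _).mp hX
  exact o'.2

/-- The law of the output completed to `L + 1` tokens with samples from the target model. -/
noncomputable def completedLaw : PMF (List V) :=
  (Φ.outputLaw L p q).bind fun o =>
    (generate p (L + 1 - o.length) o).map fun z => o ++ z.toList

/-- Each output `a₁ … aⱼ` is completed to `a` with probability `p a / p (a₁ … aⱼ)`. -/
theorem toReal_completedLaw_apply {a : List V} (ha : a.length = L + 1) (hpa : seqProb p a ≠ 0) :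
    (Φ.completedLaw L p q a).toReal = (1 - Φ.nodeBudget L p q a) * seqProb p a := by
  classical
  have hcompl : ∀ j ≤ L + 1, (((generate p (L + 1 - (a.take j).length) (a.take j)).map
      fun z => a.take j ++ z.toList) a).toReal = seqProb p a / seqProb p (a.take j) := by
    intro j hj
    have hinj : Function.Injective fun z : List.Vector V (L + 1 - (a.take j).length) =>
        a.take j ++ z.toList := fun z w h =>
      List.Vector.eq _ _ (List.append_cancel_left h)
    obtain ⟨w, hw⟩ : ∃ w : List.Vector V (L + 1 - (a.take j).length), w.toList = a.drop j :=
      ⟨⟨a.drop j, by simp [ha, hj]⟩, rfl⟩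
    have h := PMF.map_apply_of_injective (generate p (L + 1 - (a.take j).length) (a.take j))
      hinj w
    simp only [hw, List.take_append_drop] at h
    rw [h, toReal_generate, hw, eq_div_iff (seqProb_take_ne_zero hpa j),
      mul_comm, ← seqProb_append, List.take_append_drop]
  have hinj : Set.InjOn a.take (Finset.Icc 1 (L + 1) : Set ℕ) := by
    intro i hi j hj hij
    have := congrArg List.length hij
    simp only [Finset.coe_Icc, Set.mem_Icc] at hi hj
    simp only [List.length_take] at this
    omega
  rw [completedLaw, PMF.bind_apply, tsum_eq_sum (s := (Finset.Icc 1 (L + 1)).image a.take),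
    ENNReal.toReal_sum fun o _ => ENNReal.mul_ne_top (PMF.apply_ne_top _ _) (PMF.apply_ne_top _ _),
    Finset.sum_image hinj, nodeBudget, sub_sub_cancel, Finset.sum_mul, ha]
  · refine Finset.sum_congr rfl fun j hj => ?_
    rw [ENNReal.toReal_mul, hcompl j (Finset.mem_Icc.mp hj).2]
    ring
  · intro o ho
    by_contra hne
    obtain ⟨h1, h2⟩ := Φ.of_mem_support_outputLaw L p q
      ((PMF.mem_support_iff _ _).mpr (left_ne_zero_of_mul hne))
    obtain ⟨z, -, hz⟩ := (PMF.mem_support_map_iff _ _ _).mp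
      ((PMF.mem_support_iff _ _).mpr (right_ne_zero_of_mul hne))
    refine ho (Finset.mem_image.mpr ⟨o.length, ?_, ?_⟩)
    · exact Finset.mem_Icc.mpr ⟨List.length_pos_iff.mpr h1, h2⟩
    · rw [← hz, List.take_left]

theorem toReal_map_generate {a : List V} (ha : a.length = L + 1) :
    (((generate p (L + 1) []).map List.Vector.toList) a).toReal = seqProb p a := by
  have hinj : Function.Injective (List.Vector.toList : List.Vector V (L + 1) → List V) :=
    fun v w h => List.Vector.eq _ _ h
  obtain ⟨v, rfl⟩ : ∃ v : List.Vector V (L + 1), v.toList = a := ⟨⟨a, ha⟩, rfl⟩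
  rw [PMF.map_apply_of_injective _ hinj, toReal_generate_nil]

/-- Target-matching says that the budgets are exhausted at the leaves. -/
theorem targetMatching_iff : Φ.TargetMatching L p q ↔
    ∀ a : List V, a.length = L + 1 → seqProb p a ≠ 0 → Φ.nodeBudget L p q a = 0 := by
  constructor
  · intro h a ha hpa
    have h1 := Φ.toReal_completedLaw_apply L p q ha hpa
    rw [completedLaw, h, toReal_map_generate L p ha] at h1
    have h2 : Φ.nodeBudget L p q a * seqProb p a = 0 := by linarith
    exact (mul_eq_zero.mp h2).resolve_right hpa
  · intro h
    refine PMF.eq_of_eqOn_support fun a hsupp => ?_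
    obtain ⟨v, -, rfl⟩ := (PMF.mem_support_map_iff _ _ _).mp hsupp
    have hpa := (PMF.toReal_ne_zero_iff _ _).mpr hsupp
    rw [toReal_map_generate L p v.toList_length] at hpa
    have h1 := Φ.toReal_completedLaw_apply L p q v.toList_length hpa
    rw [h _ v.toList_length hpa, sub_zero, one_mul,
      ← toReal_map_generate L p v.toList_length] at h1
    exact (ENNReal.toReal_eq_toReal_iff' (PMF.apply_ne_top _ _) (PMF.apply_ne_top _ _)).mp h1

variable {Φ L p q}

theorem TargetMatching.outputLaw_eq_zero (h : Φ.TargetMatching L p q) {o : List V}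
    (ho : seqProb p o = 0) : Φ.outputLaw L p q o = 0 := by
  by_contra hne
  have hlen := (Φ.of_mem_support_outputLaw L p q ((PMF.mem_support_iff _ _).mpr hne)).2
  obtain ⟨z, hz⟩ := (generate p (L + 1 - o.length) o).support_nonempty
  have hmem : o ++ z.toList ∈ (Φ.completedLaw L p q).support :=
    (PMF.mem_support_bind_iff _ _ _).mpr ⟨o, (PMF.mem_support_iff _ _).mpr hne,
      (PMF.mem_support_map_iff _ _ _).mpr ⟨z, hz, rfl⟩⟩
  rw [completedLaw, h, ← PMF.toReal_ne_zero_iff, toReal_map_generate L p (by simp; omega),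
    seqProb_append, ho, zero_mul] at hmem
  exact hmem rfl

theorem TargetMatching.outputLaw_concat (h : Φ.TargetMatching L p q) (a : List V) (x : V) :
    (Φ.outputLaw L p q (a ++ [x])).toReal =
      (Φ.nodeBudget L p q a - Φ.nodeBudget L p q (a ++ [x])) * seqProb p (a ++ [x]) := by
  rw [nodeBudget_concat, sub_sub_cancel]
  by_cases hp : seqProb p (a ++ [x]) = 0
  · simp [h.outputLaw_eq_zero hp]
  · rw [div_mul_cancel₀ _ hp]

open scoped Classical in
/-- `D a * p a` is the probability that the output strictly extends `a`. -/
theorem TargetMatching.sum_outputLaw [Fintype V] (h : Φ.TargetMatching L p q) {a : List V}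
    (ha : a.length ≤ L + 1) :
    ∑ o ∈ seqsLE V (L + 1) with o ≠ [] ∧ a <+: o.dropLast, (Φ.outputLaw L p q o).toReal =
      Φ.nodeBudget L p q a * seqProb p a := by
  refine sum_strict_extensions p (L + 1) _ _ (fun a x _ => h.outputLaw_concat a x) ?_ a ha
  intro b hb
  by_cases hp : seqProb p b = 0
  · rw [hp, mul_zero]
  · rw [(targetMatching_iff Φ L p q).mp h b hb hp, zero_mul]

/-- Both sides count the strict prefixes of the output. -/
theorem TargetMatching.objective_nodeBudget [Fintype V] (h : Φ.TargetMatching L p q) :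
    objective L p (Φ.nodeBudget L p q) = Φ.blockEfficiency L p q := by
  classical
  have hcount : ∀ o ∈ seqsLE V (L + 1),
      ((seqsLE V L).filter fun a => o ≠ [] ∧ a <+: o.dropLast).card = o.length := by
    intro o ho
    have hlen := mem_seqsLE.mp ho
    rw [← Finset.card_range o.length]
    refine Finset.card_bij' (fun a _ => a.length) (fun j _ => o.take j) ?_ ?_ ?_ ?_
    · intro a ha
      obtain ⟨-, hne, hpre⟩ := Finset.mem_filter.mp ha
      have h1 := hpre.length_le
      have h2 := List.length_pos_iff.mpr hne
      rw [List.length_dropLast] at h1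
      exact Finset.mem_range.mpr (by omega)
    · intro j hj
      have hj := Finset.mem_range.mp hj
      refine Finset.mem_filter.mpr ⟨mem_seqsLE.mpr (by simp; omega), ?_, ?_⟩
      · rintro rfl; simp at hj
      · rw [List.dropLast_eq_take]
        exact List.take_prefix_take_left (by omega)
    · intro a ha
      obtain ⟨-, -, hpre⟩ := Finset.mem_filter.mp ha
      exact (List.prefix_iff_eq_take.mp (hpre.trans (List.dropLast_prefix o))).symm
    · intro j hj
      have hj := Finset.mem_range.mp hj
      simp only [List.length_take]
      omega
  rw [objective, blockEfficiency]
  calc ∑ a ∈ seqsLE V L, Φ.nodeBudget L p q a * seqProb p a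
      = ∑ a ∈ seqsLE V L, ∑ o ∈ seqsLE V (L + 1),
          if o ≠ [] ∧ a <+: o.dropLast then (Φ.outputLaw L p q o).toReal else 0 := by
        refine Finset.sum_congr rfl fun a ha => ?_
        rw [← h.sum_outputLaw ((mem_seqsLE.mp ha).trans (Nat.le_succ L)), Finset.sum_filter]
    _ = ∑ o ∈ seqsLE V (L + 1), (Φ.outputLaw L p q o).toReal * o.length := by
        rw [Finset.sum_comm]
        refine Finset.sum_congr rfl fun o ho => ?_
        rw [← Finset.sum_filter, Finset.sum_const, hcount o ho, nsmul_eq_mul, mul_comm]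

open scoped Classical in
/-- By prefix-matching, the output can only pass through `T` when some draft block does. -/
theorem PrefixMatching.sum_outputLaw_le [Fintype V] (h : Φ.PrefixMatching L p q)
    (T : Finset (List V)) :
    ∑ o ∈ seqsLE V (L + 1) with o ≠ [] ∧ ∃ t ∈ T, t <+: o.dropLast,
        (Φ.outputLaw L p q o).toReal ≤
      ∑ X : Fin K → List.Vector V L with ∃ k, ∃ t ∈ T, t <+: (X k).toList,
        (iid (generate q L []) K X).toReal := by
  simp only [outputLaw, PMF.toReal_bind_apply]
  rw [Finset.sum_comm, Finset.sum_filter]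
  refine Finset.sum_le_sum fun X _ => ?_
  rw [← Finset.mul_sum]
  split_ifs with hX
  · exact mul_le_of_le_one_right ENNReal.toReal_nonneg (PMF.sum_toReal_le_one _ _)
  · by_cases hs : X ∈ (iid (generate q L []) K).support
    · rw [Finset.sum_eq_zero, mul_zero]
      intro o ho
      by_contra hne
      obtain ⟨o', ho', rfl⟩ := (PMF.mem_support_map_iff _ _ _).mp
        ((PMF.toReal_ne_zero_iff _ _).mp hne)
      obtain ⟨k, hk⟩ := h X hs o' ho'
      obtain ⟨-, -, t, ht, hto⟩ := Finset.mem_filter.mp ho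
      exact hX ⟨k, t, ht, hto.trans hk⟩
    · rw [(PMF.apply_eq_zero_iff _ _).mpr hs, ENNReal.toReal_zero, zero_mul]

/-- The antichain constraint compares two probabilities: that the output without its last token
passes through `T`, and that some draft block does. -/
theorem IsValidFor.isFeasible [Fintype V] (h : Φ.IsValidFor L p q) :
    IsFeasible K L p q (Φ.nodeBudget L p q) := by
  classical
  obtain ⟨hpre, htar⟩ := h
  refine ⟨nodeBudget_nil .., ?_, (targetMatching_iff Φ L p q).mp htar, ?_⟩
  · intro a ha _ i hi
    rw [List.take_succ_eq_append_getElem (by omega), nodeBudget_concat]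
    exact sub_le_self _ (div_nonneg ENNReal.toReal_nonneg (seqProb_nonneg _ _))
  · intro T hTL hT
    have hsum : ∑ t ∈ T, Φ.nodeBudget L p q t * seqProb p t =
        ∑ o ∈ seqsLE V (L + 1) with o ≠ [] ∧ ∃ t ∈ T, t <+: o.dropLast,
          (Φ.outputLaw L p q o).toReal := by
      rw [← Finset.filter_filter, Finset.sum_filter]
      simp only [← sum_ite_prefix_of_isAntichain hT]
      rw [Finset.sum_comm]
      refine Finset.sum_congr rfl fun t ht => ?_
      rw [← htar.sum_outputLaw ((mem_seqsLE.mp (hTL ht)).trans (Nat.le_succ L)),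
        ← Finset.filter_filter, Finset.sum_filter]
    have hle := hpre.sum_outputLaw_le T
    rw [← hsum, sum_iid_generate_exists_prefix K q hTL hT] at hle
    linarith

end KPathAlgorithm
/-! ### Realizing feasible budgets -/

namespace KPathAlgorithm

variable {K : ℕ}

/-- The algorithm that ignores the draft blocks and returns one token sampled from the target. -/
noncomputable def firstToken (V : Type*) (K : ℕ) : KPathAlgorithm V K := fun _ target _ _ =>
  target.map fun v => ⟨[v.head], by simp, by simp⟩

theorem firstToken_isValid (hK : 1 ≤ K) : (firstToken V K).IsValid := by
  refine fun L p q => ⟨fun X _ o ho => ⟨⟨0, hK⟩, ?_⟩, ?_⟩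
  · obtain ⟨v, -, rfl⟩ := (PMF.mem_support_map_iff _ _ _).mp ho
    simp
  · simp only [TargetMatching, outputLaw, rule, firstToken, PMF.bind_const, PMF.map_comp, generate,
      PMF.map_bind, PMF.bind_bind]
    refine congrArg _ (funext fun x => ?_)
    have h : (Subtype.val ∘ (fun v : List.Vector V (L + 1) =>
        (⟨[v.head], by simp, by simp⟩ : Output V L)) ∘ fun z => List.Vector.cons x z) =
        Function.const _ [x] := by
      funext z
      simp
    rw [h, PMF.map_const, PMF.pure_bind]
    simp only [List.length_singleton, List.nil_append]
    refine congrArg (fun g => PMF.map g (generate p L [x])) (funext fun z => ?_)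
    simp

theorem isValidFor_of_rule_eq {Φ Ψ : KPathAlgorithm V K} {L : ℕ} {p q : LanguageModel V}
    (h : Φ.rule L p q = Ψ.rule L p q) (hΨ : Ψ.IsValidFor L p q) : Φ.IsValidFor L p q := by
  simpa only [IsValidFor, PrefixMatching, TargetMatching, outputLaw, h] using hΨ

/-- Validity depends on the models only through the joint distributions that the algorithm sees. -/
theorem IsValidFor.of_generate_eq [Finite V] {Φ : KPathAlgorithm V K} {L : ℕ}
    {p q p' q' : LanguageModel V} (h : Φ.IsValidFor L p q)
    (hp : generate p' (L + 1) [] = generate p (L + 1) [])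
    (hq : generate q' L [] = generate q L []) : Φ.IsValidFor L p' q' := by
  obtain ⟨hpre, htar⟩ := h
  have hrule : Φ.rule L p' q' = Φ.rule L p q := by rw [rule, rule, hp, hq]
  have hout : Φ.outputLaw L p' q' = Φ.outputLaw L p q := by
    rw [outputLaw, outputLaw, hrule, hq]
  refine ⟨by simpa only [PrefixMatching, hrule, hq] using hpre, ?_⟩
  rw [targetMatching_iff] at htar ⊢
  intro a ha hpa
  have hseq : ∀ b : List V, b.length ≤ L + 1 → seqProb p' b = seqProb p b :=
    fun b hb => seqProb_eq_of_generate_eq hp hb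
  rw [hseq a ha.le] at hpa
  rw [← htar a ha hpa, nodeBudget, nodeBudget, hout]
  congr 1
  refine Finset.sum_congr rfl fun j _ => ?_
  rw [hseq _ ((List.length_take_le' _ _).trans ha.le)]

/-- The algorithm that uses the rule `r` on one instance and `firstToken` on all others. -/
noncomputable def onInstance (L : ℕ) (p q : LanguageModel V)
    (r : (Fin K → List.Vector V L) → PMF (Output V L)) : KPathAlgorithm V K :=
  open scoped Classical in
  Function.update (firstToken V K) L fun target draft X =>
    if target = generate p (L + 1) [] ∧ draft = generate q L [] then r X
    else firstToken V K L target draft X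

theorem rule_onInstance (L : ℕ) (p q : LanguageModel V)
    (r : (Fin K → List.Vector V L) → PMF (Output V L)) :
    (onInstance L p q r).rule L p q = r := by
  funext X
  simp [rule, onInstance]

theorem onInstance_isValid [Finite V] (hK : 1 ≤ K) {L : ℕ} {p q : LanguageModel V}
    {r : (Fin K → List.Vector V L) → PMF (Output V L)}
    (h : (onInstance L p q r).IsValidFor L p q) : (onInstance L p q r).IsValid := by
  intro L' p' q'
  by_cases hL : L' = L
  · subst hL
    by_cases hpq : generate p' (L' + 1) [] = generate p (L' + 1) [] ∧
        generate q' L' [] = generate q L' []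
    · exact h.of_generate_eq hpq.1 hpq.2
    · refine isValidFor_of_rule_eq ?_ (firstToken_isValid hK L' p' q')
      funext X
      simp [rule, onInstance, hpq]
  · refine isValidFor_of_rule_eq ?_ (firstToken_isValid hK L' p' q')
    simp [rule, onInstance, Function.update_of_ne hL]

end KPathAlgorithm

namespace IsFeasible

variable {K L : ℕ} {p q : LanguageModel V} {D : List V → ℝ}

/-- The probability that an algorithm with budgets `D` must give to the output `o`. -/
noncomputable def outputMass (p : LanguageModel V) (D : List V → ℝ) (o : List V) : ℝ :=
  (D o.dropLast - D o) * seqProb p o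

theorem outputMass_concat (p : LanguageModel V) (D : List V → ℝ) (a : List V) (x : V) :
    outputMass p D (a ++ [x]) = (D a - D (a ++ [x])) * seqProb p (a ++ [x]) := by
  simp [outputMass]

theorem outputMass_nonneg [Finite V] (h : IsFeasible K L p q D) {o : List V} (hne : o ≠ [])
    (ho : o.length ≤ L + 1) : 0 ≤ outputMass p D o := by
  by_cases hp : seqProb p o = 0
  · simp [outputMass, hp]
  obtain ⟨b, hb, hpb⟩ := exists_extension hp (L + 1 - o.length)
  have hpos := List.length_pos_iff.mpr hne
  have := h.antitone (o ++ b) (by simp; omega) hpb (o.length - 1) (by omega)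
  rw [Nat.sub_add_cancel hpos, List.take_left, List.take_append_of_le_length (by omega),
    ← List.dropLast_eq_take] at this
  exact mul_nonneg (sub_nonneg.mpr this) (seqProb_nonneg p o)

open scoped Classical in
theorem sum_outputMass [Fintype V] (h : IsFeasible K L p q D) {a : List V}
    (ha : a.length ≤ L + 1) :
    ∑ o ∈ seqsLE V (L + 1) with o ≠ [] ∧ a <+: o.dropLast, outputMass p D o =
      D a * seqProb p a := by
  refine sum_strict_extensions p (L + 1) _ D (fun a x _ => outputMass_concat p D a x) ?_ a ha
  intro b hb
  by_cases hp : seqProb p b = 0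
  · rw [hp, mul_zero]
  · rw [h.leaf b hb hp, zero_mul]

theorem sum_outputMass_output [Fintype V] [Fintype (Output V L)] (h : IsFeasible K L p q D) :
    ∑ o : Output V L, outputMass p D o.val = 1 := by
  classical
  have hroot := h.sum_outputMass (a := []) (Nat.zero_le _)
  rw [h.root, seqProb_nil, one_mul] at hroot
  rw [← hroot]
  refine (Finset.sum_subtype _ (fun o => ?_) _).symm
  simp [mem_seqsLE, and_comm]

/-- Hall's condition for matching outputs with draft blocks: a set of outputs only matters through
the antichain of the minimal sequences that its members strictly extend. -/
theorem hall [Fintype V] (h : IsFeasible K L p q D) (A : Finset (Output V L))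
    (B : Finset (Fin K → List.Vector V L))
    (hAB : ∀ o ∈ A, ∀ X : Fin K → List.Vector V L,
      (∃ k, o.val.dropLast <+: (X k).toList) → X ∈ B) :
    ∑ o ∈ A, outputMass p D o.val ≤ ∑ X ∈ B, (iid (generate q L []) K X).toReal := by
  classical
  obtain ⟨T, hTA, hT, hmin⟩ := exists_antichain_prefix (A.image fun o => o.val.dropLast)
  have hTL : T ⊆ seqsLE V L := by
    intro t ht
    obtain ⟨o, -, rfl⟩ := Finset.mem_image.mp (hTA ht)
    have := o.2.2
    exact mem_seqsLE.mpr (by simp; omega)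
  have hmass : ∑ o ∈ A, outputMass p D o.val ≤ ∑ t ∈ T, D t * seqProb p t := by
    calc ∑ o ∈ A, outputMass p D o.val
        = ∑ o ∈ A.image Subtype.val, outputMass p D o := by
          rw [Finset.sum_image fun _ _ _ _ h => Subtype.ext h]
      _ ≤ ∑ o ∈ T.biUnion fun t =>
            (seqsLE V (L + 1)).filter fun o => o ≠ [] ∧ t <+: o.dropLast, outputMass p D o := by
          refine Finset.sum_le_sum_of_subset_of_nonneg ?_ ?_
          · intro o ho
            obtain ⟨o, hoA, rfl⟩ := Finset.mem_image.mp ho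
            obtain ⟨t, ht, hto⟩ := hmin _ (Finset.mem_image_of_mem _ hoA)
            exact Finset.mem_biUnion.mpr ⟨t, ht, Finset.mem_filter.mpr
              ⟨mem_seqsLE.mpr o.2.2, o.2.1, hto⟩⟩
          · intro o ho _
            obtain ⟨t, -, ho⟩ := Finset.mem_biUnion.mp ho
            obtain ⟨ho, hne, -⟩ := Finset.mem_filter.mp ho
            exact h.outputMass_nonneg hne (mem_seqsLE.mp ho)
      _ = ∑ t ∈ T, D t * seqProb p t := by
          rw [Finset.sum_biUnion]
          · exact Finset.sum_congr rfl fun t ht =>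
              h.sum_outputMass ((mem_seqsLE.mp (hTL ht)).trans (Nat.le_succ L))
          · intro s hs t ht hst
            refine Finset.disjoint_left.mpr fun o hso hto => ?_
            rcases List.prefix_or_prefix_of_prefix (Finset.mem_filter.mp hso).2.2
              (Finset.mem_filter.mp hto).2.2 with h | h
            · exact hT hs ht hst h
            · exact hT ht hs hst.symm h
  have hblocks : ∑ X : Fin K → List.Vector V L with ∃ k, ∃ t ∈ T, t <+: (X k).toList,
      (iid (generate q L []) K X).toReal ≤ ∑ X ∈ B, (iid (generate q L []) K X).toReal := by
    refine Finset.sum_le_sum_of_subset_of_nonneg (fun X hX => ?_)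
      fun _ _ _ => ENNReal.toReal_nonneg
    obtain ⟨-, k, t, ht, htX⟩ := Finset.mem_filter.mp hX
    obtain ⟨o, ho, rfl⟩ := Finset.mem_image.mp (hTA ht)
    exact hAB o ho X ⟨k, htX⟩
  have := h.antichain T hTL hT
  have heq := sum_iid_generate_exists_prefix K q hTL hT
  linarith

/-- A prefix-matching rule whose output has the masses `outputMass p D`: condition the coupling of
outputs and draft blocks on the blocks. -/
theorem exists_rule [Fintype V] (h : IsFeasible K L p q D) :
    ∃ r : (Fin K → List.Vector V L) → PMF (Output V L),
      (∀ X ∈ (iid (generate q L []) K).support, ∀ o ∈ (r X).support,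
        ∃ k : Fin K, o.val.dropLast <+: (X k).toList) ∧
      ∀ o, (((iid (generate q L []) K).bind r) o).toReal = outputMass p D o.val := by
  classical
  have : Finite (Output V L) :=
    (List.finite_length_le V (L + 1)).subset fun o (ho : o ≠ [] ∧ o.length ≤ L + 1) => ho.2
  have := Fintype.ofFinite (Output V L)
  set ν := iid (generate q L []) K
  obtain ⟨π, hπ0, hπR, hπ1, hπ2⟩ := exists_coupling_of_hall
    (fun (o : Output V L) (X : Fin K → List.Vector V L) =>
      ∃ k, o.val.dropLast <+: (X k).toList)
    (fun o => outputMass p D o.val) (fun X => (ν X).toReal)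
    h.sum_outputMass_output ν.sum_toReal h.hall
  -- the value at blocks outside the support of `ν` is irrelevant
  let r : (Fin K → List.Vector V L) → PMF (Output V L) := fun X =>
    if hX : (ν X).toReal = 0 then KPathAlgorithm.firstToken V K L (generate p (L + 1) [])
      (generate q L []) X
    else PMF.ofReal (fun o => π o X / (ν X).toReal)
      (fun o => div_nonneg (hπ0 o X) ENNReal.toReal_nonneg)
      (by rw [← Finset.sum_div, hπ2, div_self hX])
  have hr : ∀ X o, (ν X).toReal * (r X o).toReal = π o X := by
    intro X o
    by_cases hX : (ν X).toReal = 0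
    · rw [hX, zero_mul]
      have := hπ2 X
      rw [hX, Finset.sum_eq_zero_iff_of_nonneg fun o _ => hπ0 o X] at this
      exact (this o (Finset.mem_univ o)).symm
    · simp only [r, dif_neg hX, PMF.toReal_ofReal_apply]
      field_simp
  refine ⟨r, fun X hX o ho => ?_, fun o => ?_⟩
  · by_contra hne
    have h1 := hr X o
    rw [hπR o X hne] at h1
    exact mul_ne_zero ((PMF.toReal_ne_zero_iff _ _).mpr hX)
      ((PMF.toReal_ne_zero_iff _ _).mpr ho) h1
  · rw [PMF.toReal_bind_apply, ← hπ1 o]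
    exact Finset.sum_congr rfl fun X _ => hr X o

theorem exists_isValid [Fintype V] (hK : 1 ≤ K) (h : IsFeasible K L p q D) :
    ∃ Φ : KPathAlgorithm V K, Φ.IsValid ∧
      ∀ a : List V, a.length ≤ L + 1 → seqProb p a ≠ 0 → Φ.nodeBudget L p q a = D a := by
  obtain ⟨r, hpre, hmass⟩ := h.exists_rule
  set Φ := KPathAlgorithm.onInstance L p q r with hΦ
  have hrule : Φ.rule L p q = r := KPathAlgorithm.rule_onInstance L p q r
  have hout : ∀ o : Output V L, (Φ.outputLaw L p q o.val).toReal = outputMass p D o.val := by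
    intro o
    rw [← hmass o, KPathAlgorithm.outputLaw, hrule, ← PMF.map_bind,
      PMF.map_apply_of_injective _ Subtype.val_injective]
  have hbudget : ∀ a : List V, a.length ≤ L + 1 → seqProb p a ≠ 0 →
      Φ.nodeBudget L p q a = D a := by
    intro a
    induction a using List.reverseRecOn with
    | nil => simp [h.root]
    | append_singleton a x ih =>
      intro ha hp
      have hlen : a.length ≤ L + 1 := by simp at ha; omega
      rw [KPathAlgorithm.nodeBudget_concat, ih hlen (seqProb_ne_zero_of_concat hp),
        hout ⟨a ++ [x], by simp, ha⟩, outputMass_concat, mul_div_cancel_right₀ _ hp,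
        sub_sub_cancel]
  refine ⟨Φ, KPathAlgorithm.onInstance_isValid hK ⟨?_, ?_⟩, hbudget⟩
  · rw [← hΦ, KPathAlgorithm.PrefixMatching, hrule]
    exact hpre
  · rw [← hΦ, KPathAlgorithm.targetMatching_iff]
    exact fun a ha hp => (hbudget a ha.le hp).trans (h.leaf a ha hp)

/-- Feasibility only concerns the sequences of positive target probability. -/
theorem congr [Finite V] {D' : List V → ℝ} (h : IsFeasible K L p q D)
    (hD : ∀ a : List V, a.length ≤ L + 1 → seqProb p a ≠ 0 → D a = D' a) :
    IsFeasible K L p q D' := by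
  refine ⟨?_, fun a ha hp i hi => ?_, fun a ha hp => ?_, fun T hTL hT => ?_⟩
  · rw [← hD [] (Nat.zero_le _) (by simp), h.root]
  · have htake : ∀ j, D (a.take j) = D' (a.take j) := fun j =>
      hD _ ((List.length_take_le' _ _).trans ha.le) (seqProb_take_ne_zero hp j)
    rw [← htake, ← htake]
    exact h.antitone a ha hp i hi
  · rw [← hD a ha.le hp, h.leaf a ha hp]
  · refine (h.antichain T hTL hT).trans_eq ?_
    congr 1
    refine Finset.sum_congr rfl fun t ht => ?_
    by_cases hp : seqProb p t = 0
    · rw [hp, mul_zero, mul_zero]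
    · rw [hD t ((mem_seqsLE.mp (hTL ht)).trans (Nat.le_succ L)) hp]

end IsFeasible

end SpecDec

theorem mainTheorem1 {V : Type*} [Finite V] (K : ℕ) (hK : 1 ≤ K) (L : ℕ)
    (p q : SpecDec.LanguageModel V) :
    (∀ Φ : SpecDec.KPathAlgorithm V K,
      Φ.IsValidFor L p q ↔
        Φ.PrefixMatching L p q ∧ SpecDec.IsFeasible K L p q (Φ.nodeBudget L p q)) ∧
    (∀ D : List V → ℝ,
      SpecDec.IsFeasible K L p q D ↔
        ∃ Φ : SpecDec.KPathAlgorithm V K, Φ.IsValid ∧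
          ∀ a : List V, a.length ≤ L + 1 → SpecDec.seqProb p a ≠ 0 →
            Φ.nodeBudget L p q a = D a) ∧
    (∀ Φ : SpecDec.KPathAlgorithm V K,
      SpecDec.IsFeasible K L p q (Φ.nodeBudget L p q) →
        SpecDec.objective L p (Φ.nodeBudget L p q) = Φ.blockEfficiency L p q) := by
  cases nonempty_fintype V
  refine ⟨fun Φ => ⟨fun h => ⟨h.1, h.isFeasible⟩, fun h => ⟨h.1, ?_⟩⟩, fun D => ⟨fun h => ?_, ?_⟩,
    fun Φ h => ?_⟩
  · exact (Φ.targetMatching_iff L p q).mpr h.2.leaf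
  · exact h.exists_isValid hK
  · rintro ⟨Φ, hΦ, hD⟩
    exact (hΦ L p q).isFeasible.congr hD
  · exact ((Φ.targetMatching_iff L p q).mpr h.leaf).objective_nodeBudget
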